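/- Vectors are compared componentwise: $x\preceq y$ means $x_j\le y_j$ for all $j$, and $x\prec y$ means $x_j<y_j$ for all $j$; $|\cdot|$, $\max$ and $\lim$ of vectors and matrices are taken entrywise; $\mathbb R^n_{+0}$ and $\mathbb R^n_{+}$ are the sets of $x\succeq 0$ and of $x\succ 0$. For $M\in\mathbb C^{n\times n}$, $\mathcal M(M)\in\mathbb R^{n\times n}$ is the matrix with entries $\operatorname{Re}M_{ii}$ on the diagonal and $|M_{il}|$ off the diagonal. A matrix is Hurwitz if all its eigenvalues have negative real part. A map $f:\mathbb R^n_{+0}\to\mathbb R^m_{+0}$ is called CNI if $0\preceq x_1\preceq x_2$ implies $f(x_1)\preceq f(x_2)$. Let $N\ge 1$ and, for $i=1,\dots,N$, let $A_i\in\mathbb R^{n\times n}$, $H_i\in\mathbb R^{n\times k_i}$, and let $\delta_i:\mathbb R^n_{+0}\to\mathbb R^{k_i}_{+0}$ be continuous and CNI; let $\bar\tau\ge 0$. Consider the switching system $$\dot x(t)=A_{\sigma(t)}x(t)+H_{\sigma(t)}w_{\sigma(t)}(t),\qquad |w_i(t)|\preceq\delta_i(\theta(t))\ \text{ for all } t\ge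 0 \text{ and all } i,\qquad \theta(t)=\max_{t-\bar\tau\le s\le t}|x(s)|,$$ with an arbitrary switching function $\sigma$ with values in $\{1,\dots,N\}$. A trajectory is a function $x$ that is continuous on $[-\bar\tau,\infty)$, locally absolutely continuous on $[0,\infty)$, and satisfies the differential equation for almost every $t\ge 0$, for some $\sigma$ and $w_1,\dots,w_N$ as above. Let $V\in\mathbb C^{n\times n}$ be invertible, let $\Lambda=\max_{i}\mathcal M(V^{-1}A_iV)$, and suppose that $\Lambda$ is Hurwitz. Let $$\psi(x)=\max_{i}\ \max_{|w|\preceq\delta_i(|V|x)}|V^{-1}H_iw|,\qquad x\in\mathbb R^n_{+0},$$ where $w$ ranges over $\mathbb R^{k_i}$, let $\delta:\mathbb R^n_{+0}\to\mathbb R^n_{+0}$ be continuous and CNI with $\delta(x)\succeq\psi(x)$ for all $x\in\mathbb R^n_{+0}$, and put $T_0(x)=-\Lambda^{-1}\delta(x)$. Suppose that there is $\beta\in\mathbb R^n_{+0}$ with $T_0(\beta)\prec\beta$. Then the limit $b=\lim_{m\to\infty}T_0^m(\beta)\succeq 0$ exists, and the following holds. Suppose in addition that for every $\varepsilon\in\mathbb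 R^n_{+}$ there is $\beta_\varepsilon$ with $b\preceq\beta_\varepsilon\preceq b+\varepsilon$ and $T_0(\beta_\varepsilon)\prec\beta_\varepsilon$. Then every trajectory $x$ with $|V^{-1}x(t)|\preceq b$ for all $-\bar\tau\le t\le 0$ satisfies $|V^{-1}x(t)|\preceq b$ for all $t\ge-\bar\tau$. -/

import Mathlib

open Set Filter Topology MeasureTheory
open scoped Matrix

namespace SwitchingSystem

noncomputable section

/-- Componentwise magnitude of the complex vector `V⁻¹ x`, for a real vector `x`. -/
def absCoord {n : ℕ} (V : Matrix (Fin n) (Fin n) ℂ) (x : Fin n → ℝ) : Fin n → ℝ :=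
  fun j => ‖(V⁻¹ *ᵥ (fun l => (x l : ℂ))) j‖

/-- The matrix `|V|` of magnitudes of the entries of `V`. -/
def absMatrix {n : ℕ} (V : Matrix (Fin n) (Fin n) ℂ) : Matrix (Fin n) (Fin n) ℝ :=
  V.map (fun z => ‖z‖)

/-- The Metzler matrix `𝓜(M)`: real parts on the diagonal, magnitudes off the diagonal. -/
def metzlerPart {n : ℕ} (M : Matrix (Fin n) (Fin n) ℂ) : Matrix (Fin n) (Fin n) ℝ :=
  Matrix.of fun i l => if i = l then (M i l).re else ‖M i l‖

/-- `Λ = max_i 𝓜(V⁻¹ A_i V)`, the maximum being taken entrywise. -/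
def Lam {N n : ℕ} (A : Fin N → Matrix (Fin n) (Fin n) ℝ) (V : Matrix (Fin n) (Fin n) ℂ) :
    Matrix (Fin n) (Fin n) ℝ :=
  Matrix.of fun j l => ⨆ i : Fin N, metzlerPart (V⁻¹ * (A i).map Complex.ofReal * V) j l

/-- All (complex) eigenvalues of the real matrix `M` have negative real part. -/
def IsHurwitz {n : ℕ} (M : Matrix (Fin n) (Fin n) ℝ) : Prop :=
  ∀ z ∈ spectrum ℂ (M.map Complex.ofReal), z.re < 0

/-- `f` maps the nonnegative orthant of `ℝⁿ` into that of `ℝᵐ`, and is continuous and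
componentwise monotone there (`0 ⪯ x₁ ⪯ x₂` implies `f x₁ ⪯ f x₂`). Values of `f` off the
nonnegative orthant play no role. -/
structure IsContCNI {n m : ℕ} (f : (Fin n → ℝ) → (Fin m → ℝ)) : Prop where
  mapsTo : MapsTo f (Ici 0) (Ici 0)
  continuousOn : ContinuousOn f (Ici 0)
  monotoneOn : MonotoneOn f (Ici 0)

/-- `ψ(x) = max_i max_{|w_i| ⪯ δ_i(|V| x)} |V⁻¹ H_i w_i|`, the maxima being componentwise. -/
def psi {N n : ℕ} {k : Fin N → ℕ} (H : ∀ i, Matrix (Fin n) (Fin (k i)) ℝ)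
    (δw : ∀ i, (Fin n → ℝ) → (Fin (k i) → ℝ)) (V : Matrix (Fin n) (Fin n) ℂ)
    (x : Fin n → ℝ) : Fin n → ℝ :=
  fun j => ⨆ i : Fin N, sSup ((fun w : Fin (k i) → ℝ => absCoord V (H i *ᵥ w) j) ''
    {w | ∀ l, |w l| ≤ δw i (absMatrix V *ᵥ x) l})

/-- `T_γ(x) = -Λ⁻¹ δ(x) + γ`. -/
def T {n : ℕ} (L : Matrix (Fin n) (Fin n) ℝ) (δ : (Fin n → ℝ) → (Fin n → ℝ))
    (γ x : Fin n → ℝ) : Fin n → ℝ :=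
  -(L⁻¹ *ᵥ δ x) + γ

/-- `θ(t) = max_{t - τ ≤ s ≤ t} |x(s)|`, componentwise. -/
def theta {n : ℕ} (τ : ℝ) (x : ℝ → Fin n → ℝ) (t : ℝ) : Fin n → ℝ :=
  fun j => sSup ((fun s => |x s j|) '' Icc (t - τ) t)

/-- `x` is a trajectory of `ẋ = A_σ x + H_σ w_σ` for the switching function `σ` and the
perturbations `w`, where `|w_i(t)| ⪯ δ_i(θ(t))` for all `t ≥ 0` and all `i`: it is continuous on
`[-τ, ∞)`, absolutely continuous on bounded subintervals of `[0, ∞)`, and satisfies the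
differential equation for almost every `t ≥ 0`. -/
structure IsTrajectory {N n : ℕ} {k : Fin N → ℕ} (A : Fin N → Matrix (Fin n) (Fin n) ℝ)
    (H : ∀ i, Matrix (Fin n) (Fin (k i)) ℝ) (δw : ∀ i, (Fin n → ℝ) → (Fin (k i) → ℝ))
    (τ : ℝ) (σ : ℝ → Fin N) (w : ∀ i, ℝ → Fin (k i) → ℝ) (x : ℝ → Fin n → ℝ) : Prop where
  continuousOn : ContinuousOn x (Ici (-τ))
  absolutelyContinuous : ∀ t, 0 ≤ t → AbsolutelyContinuousOnInterval x 0 t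
  hasDerivAt : ∀ᵐ t ∂(volume.restrict (Ici (0 : ℝ))),
    HasDerivAt x (A (σ t) *ᵥ x t + H (σ t) *ᵥ w (σ t) t) t
  bound : ∀ t, 0 ≤ t → ∀ i l, |w i t l| ≤ δw i (theta τ x t) l

end

end SwitchingSystem

open Set Filter Topology MeasureTheory
open scoped Matrix

namespace SwitchingSystem

/-! Since `Λ` is Metzler and Hurwitz, `-Λ⁻¹` preserves the nonnegative orthant
(`IsHurwitz.neg_inv_mulVec_nonneg`). Hence `T_0` is monotone, and its iterates from `β` decrease to
a fixed point `b`.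

At `b` one only has `Λ b + δ(b) = 0`, which leaves no margin for an exit argument. So the box is
approximated from outside by boxes with corner `c`, where `b ≺ c ⪯ b + ε` and `Λ c + δ(c) ≺ 0`
(`exists_strict_supersolution`).

Such a box cannot be left (`IsTrajectory.absCoord_strongLT`): if `|V⁻¹ x|_j` is a coordinate
reaching `c_j` at the first exit time, the delayed perturbation has so far been bounded by `δ(c)`,
so just before that time the derivative of `|V⁻¹ x|_j ^ 2` is nonpositive, and the coordinate cannot
have risen to `c_j`. Letting `ε → 0` gives the claim. -/

/-- A matrix is Metzler if its off-diagonal entries are nonnegative. -/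
def IsMetzler {n : ℕ} (L : Matrix (Fin n) (Fin n) ℝ) : Prop :=
  ∀ i j, i ≠ j → 0 ≤ L i j

/-! ### Inverse positivity of Hurwitz Metzler matrices. -/

lemma IsHurwitz.isUnit_det_smul_one_sub {n : ℕ} {L : Matrix (Fin n) (Fin n) ℝ}
    (hL : IsHurwitz L) {μ : ℝ} (hμ : 0 ≤ μ) : IsUnit (μ • (1 : Matrix (Fin n) (Fin n) ℝ) - L).det := by
  by_contra h
  have hmem : (μ : ℂ) ∈ spectrum ℂ (L.map Complex.ofReal) := by
    rw [spectrum.mem_iff]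
    intro hu
    have hmap : algebraMap ℂ (Matrix (Fin n) (Fin n) ℂ) (μ : ℂ) - L.map Complex.ofReal
        = (Complex.ofRealHom).mapMatrix (μ • (1 : Matrix (Fin n) (Fin n) ℝ) - L) := by
      ext i j
      by_cases hij : i = j <;> simp [Matrix.algebraMap_matrix_apply, hij]
    rw [hmap, Matrix.isUnit_iff_isUnit_det, ← RingHom.map_det] at hu
    apply h
    rw [isUnit_iff_ne_zero] at hu ⊢
    intro h0
    exact hu (by rw [h0, map_zero])
  have := hL _ hmem
  simp at this
  linarith

lemma IsHurwitz.isUnit_det {n : ℕ} {L : Matrix (Fin n) (Fin n) ℝ} (hL : IsHurwitz L) :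
    IsUnit L.det := by
  have := hL.isUnit_det_smul_one_sub le_rfl
  rw [zero_smul, zero_sub, Matrix.det_neg] at this
  exact isUnit_of_mul_isUnit_right this

lemma smul_one_sub_mulVec_apply {n : ℕ} (L : Matrix (Fin n) (Fin n) ℝ) (μ : ℝ) (v : Fin n → ℝ)
    (j : Fin n) :
    ((μ • (1 : Matrix (Fin n) (Fin n) ℝ) - L) *ᵥ v) j = μ * v j - ∑ l, L j l * v l := by
  rw [Matrix.sub_mulVec, Matrix.smul_mulVec, Matrix.one_mulVec]
  rfl

/-- If `(μ - L) v ≻ 0` with `L` Metzler and `v ⪰ 0`, then `v ≻ 0`. -/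
lemma IsMetzler.strongLT_of_nonneg {n : ℕ} {L : Matrix (Fin n) (Fin n) ℝ} (hM : IsMetzler L)
    {μ : ℝ} {v : Fin n → ℝ}
    (hv : StrongLT 0 ((μ • (1 : Matrix (Fin n) (Fin n) ℝ) - L) *ᵥ v)) (h0 : 0 ≤ v) :
    StrongLT 0 v := by
  intro j
  refine lt_of_le_of_ne (h0 j) fun hj => ?_
  -- If `v j = 0`, row `j` of `(μ - L) v` is minus a sum of nonnegative terms.
  have h1 := hv j
  rw [smul_one_sub_mulVec_apply, ← hj] at h1
  have h2 : 0 ≤ ∑ l, L j l * v l := by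
    refine Finset.sum_nonneg fun l _ => ?_
    by_cases hl : j = l
    · subst hl
      simp [← hj]
    · exact mul_nonneg (hM _ _ hl) (h0 l)
  simp at h1 h2
  linarith

/-- If `(μ - L) v ≻ 0` with `L` Metzler and `μ` above all row sums of `L`, then `v ⪰ 0`. -/
lemma IsMetzler.nonneg_of_rowSum_lt {n : ℕ} {L : Matrix (Fin n) (Fin n) ℝ} (hM : IsMetzler L)
    {μ : ℝ} (hμ : ∀ j, ∑ l, L j l < μ) {v : Fin n → ℝ}
    (hv : StrongLT 0 ((μ • (1 : Matrix (Fin n) (Fin n) ℝ) - L) *ᵥ v)) : 0 ≤ v := by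
  intro i
  -- At a minimal coordinate `v j < 0`, row `j` of `(μ - L) v` would be at most `(μ - ∑ l, L j l) *
  -- v j < 0`.
  obtain ⟨j, -, hj⟩ := Finset.exists_min_image Finset.univ v ⟨i, Finset.mem_univ i⟩
  refine le_trans ?_ (hj i (Finset.mem_univ i))
  by_contra hneg
  have h1 := hv j
  rw [smul_one_sub_mulVec_apply] at h1
  have h2 : ∑ l, L j l * v j ≤ ∑ l, L j l * v l := by
    refine Finset.sum_le_sum fun l _ => ?_
    by_cases hl : j = l
    · rw [hl]
    · exact mul_le_mul_of_nonneg_left (hj l (Finset.mem_univ l)) (hM _ _ hl)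
  rw [← Finset.sum_mul] at h2
  simp only [Pi.zero_apply, not_le] at h1 hneg
  nlinarith [hμ j]

/-- For a Hurwitz Metzler matrix `L`, the matrix `-L⁻¹` maps positive vectors to positive ones. -/
lemma IsHurwitz.strongLT_neg_inv_mulVec {n : ℕ} {L : Matrix (Fin n) (Fin n) ℝ} (hL : IsHurwitz L)
    (hM : IsMetzler L) {y : Fin n → ℝ} (hy : StrongLT 0 y) : StrongLT 0 (-(L⁻¹ *ᵥ y)) := by
  -- Continuation in `μ`: the set of `μ ≥ 0` with `(μ - L)⁻¹ y ≻ 0` is open, is closed because `⪰ 0`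
  -- already forces `≻ 0`, and contains large `μ`. By connectedness it contains `0`.
  let R : ℝ → Matrix (Fin n) (Fin n) ℝ := fun μ => μ • (1 : Matrix (Fin n) (Fin n) ℝ) - L
  let v : Ici (0 : ℝ) → Fin n → ℝ := fun μ => (R μ)⁻¹ *ᵥ y
  have hRv (μ : Ici (0 : ℝ)) : StrongLT 0 (R μ *ᵥ v μ) := by
    simp only [v, Matrix.mulVec_mulVec, R]
    rwa [Matrix.mul_nonsing_inv _ (hL.isUnit_det_smul_one_sub μ.2), Matrix.one_mulVec]
  have hRc : Continuous fun μ : Ici (0 : ℝ) => R μ := by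
    simp only [R]; fun_prop
  have hvc : Continuous v := by
    have hinv : Continuous fun μ : Ici (0 : ℝ) => (R μ)⁻¹ := by
      simp only [Matrix.inv_def, Ring.inverse_eq_inv']
      exact (hRc.matrix_det.inv₀ fun μ => (hL.isUnit_det_smul_one_sub μ.2).ne_zero).smul
        hRc.matrix_adjugate
    exact hinv.matrix_mulVec continuous_const
  have hset : {μ | StrongLT 0 (v μ)} = {μ | 0 ≤ v μ} :=
    Set.ext fun μ => ⟨fun h => h.le, fun h => hM.strongLT_of_nonneg (hRv μ) h⟩
  have hclopen : IsClopen {μ | StrongLT 0 (v μ)} := by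
    constructor
    · rw [hset]
      exact isClosed_le continuous_const hvc
    · have : {μ | StrongLT 0 (v μ)} = ⋂ j, {μ | 0 < v μ j} := by
        ext μ; simp [StrongLT]
      rw [this]
      exact isOpen_iInter_of_finite fun j =>
        isOpen_lt continuous_const ((continuous_apply j).comp hvc)
  have hne : {μ | StrongLT 0 (v μ)}.Nonempty := by
    obtain ⟨C, hC⟩ := (Set.finite_range fun j => ∑ l, L j l).bddAbove
    refine ⟨⟨max 0 (C + 1), mem_Ici.2 (le_max_left _ _)⟩, ?_⟩
    rw [hset]
    refine hM.nonneg_of_rowSum_lt (fun j => ?_) (hRv _)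
    have := hC ⟨j, rfl⟩
    exact lt_of_lt_of_le (by simpa using lt_of_le_of_lt this (lt_add_one C)) (le_max_right _ _)
  have : PreconnectedSpace (Ici (0 : ℝ)) := Subtype.preconnectedSpace isPreconnected_Ici
  have huniv := hclopen.eq_univ hne
  have h0 : (⟨0, self_mem_Ici⟩ : Ici (0 : ℝ)) ∈ {μ | StrongLT 0 (v μ)} := by
    rw [huniv]; trivial
  have hinv : (-L)⁻¹ = -L⁻¹ := Matrix.inv_eq_left_inv (by
    rw [neg_mul_neg, Matrix.nonsing_inv_mul _ hL.isUnit_det])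
  simpa [v, R, hinv, Matrix.neg_mulVec] using h0

/-- For a Hurwitz Metzler matrix `L`, the matrix `-L⁻¹` is nonnegative. -/
lemma IsHurwitz.neg_inv_mulVec_nonneg {n : ℕ} {L : Matrix (Fin n) (Fin n) ℝ} (hL : IsHurwitz L)
    (hM : IsMetzler L) {y : Fin n → ℝ} (hy : 0 ≤ y) : 0 ≤ -(L⁻¹ *ᵥ y) := by
  have hc : Continuous fun ε : ℝ => -(L⁻¹ *ᵥ (y + fun _ => ε)) :=
    (continuous_const.matrix_mulVec
      (continuous_const.add (continuous_pi fun _ => continuous_id))).neg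
  have ht : Tendsto (fun ε : ℝ => -(L⁻¹ *ᵥ (y + fun _ => ε))) (𝓝[>] 0) (𝓝 (-(L⁻¹ *ᵥ y))) := by
    have := (hc.tendsto 0).mono_left (nhdsWithin_le_nhds (s := Ioi 0))
    have hz : (y + fun _ => (0 : ℝ)) = y := by ext; simp
    rwa [hz] at this
  refine ge_of_tendsto ht ?_
  filter_upwards [self_mem_nhdsWithin] with ε hε
  exact (hL.strongLT_neg_inv_mulVec hM fun j => add_pos_of_nonneg_of_pos (hy j) hε).le

/-! ### Monotone iteration and strict supersolutions. -/

/-- The iterates of a continuous monotone self-map of the nonnegative orthant, started from a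
point that it decreases, converge to a fixed point above any given sub-fixed point. -/
lemma exists_tendsto_iterate {n : ℕ} {F : (Fin n → ℝ) → (Fin n → ℝ)}
    (hc : ContinuousOn F (Ici 0)) (hm : MonotoneOn F (Ici 0)) {p a : Fin n → ℝ}
    (hp : 0 ≤ p) (hpa : p ≤ a) (hFp : p ≤ F p) (hFa : F a ≤ a) :
    ∃ c, p ≤ c ∧ c ≤ a ∧ F c = c ∧ Tendsto (fun m : ℕ => F^[m] a) atTop (𝓝 c) := by
  have hlow : ∀ m, p ≤ F^[m] a := by
    intro m
    induction m with
    | zero => exact hpa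
    | succ m ih =>
      rw [Function.iterate_succ_apply']
      exact hFp.trans (hm hp (hp.trans ih) ih)
  have hanti : Antitone fun m => F^[m] a := by
    refine antitone_nat_of_succ_le fun m => ?_
    induction m with
    | zero => exact hFa
    | succ m ih =>
      simp only [Function.iterate_succ_apply'] at ih ⊢
      exact hm (hp.trans (Function.iterate_succ_apply' F m a ▸ hlow (m + 1)))
        (hp.trans (hlow m)) ih
  have hbdd : BddBelow (range fun m => F^[m] a) := ⟨p, by rintro _ ⟨m, rfl⟩; exact hlow m⟩
  have ht := tendsto_atTop_ciInf hanti hbdd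
  set c := ⨅ m, F^[m] a
  have hpc : p ≤ c := ge_of_tendsto' ht hlow
  refine ⟨c, hpc, le_of_tendsto' ht fun m => hanti (Nat.zero_le m), ?_, ht⟩
  have h1 : Tendsto (fun m => F (F^[m] a)) atTop (𝓝 (F c)) :=
    (hc c (hp.trans hpc)).tendsto.comp
      (tendsto_nhdsWithin_iff.2 ⟨ht, Eventually.of_forall fun m => hp.trans (hlow m)⟩)
  refine tendsto_nhds_unique h1 ?_
  simpa only [← Function.iterate_succ_apply'] using! (tendsto_add_atTop_iff_nat 1).2 ht

section Comparison

variable {n : ℕ} {L : Matrix (Fin n) (Fin n) ℝ} {δ : (Fin n → ℝ) → (Fin n → ℝ)}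

lemma continuousOn_T (hδ : IsContCNI δ) (γ : Fin n → ℝ) : ContinuousOn (T L δ γ) (Ici 0) := by
  have h : Continuous fun v : Fin n → ℝ => -(L⁻¹ *ᵥ v) + γ :=
    (Continuous.matrix_mulVec continuous_const continuous_id).neg.add continuous_const
  exact h.comp_continuousOn hδ.continuousOn

lemma monotoneOn_T (hL : IsHurwitz L) (hM : IsMetzler L) (hδ : IsContCNI δ) (γ : Fin n → ℝ) :
    MonotoneOn (T L δ γ) (Ici 0) := by
  intro x hx y hy hxy
  have h := hL.neg_inv_mulVec_nonneg hM (sub_nonneg.2 (hδ.monotoneOn hx hy hxy))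
  rw [Matrix.mulVec_sub, neg_sub] at h
  have h' := sub_nonneg.1 h
  exact add_le_add_left (neg_le_neg h') γ

/-- Above a fixed point `b` of `T_0` and below a point strictly decreased by `T_0` there is
`c ≻ b` with `L c + δ(c) ≺ 0`. -/
lemma exists_strict_supersolution (hL : IsHurwitz L) (hM : IsMetzler L) (hδ : IsContCNI δ)
    {b a : Fin n → ℝ} (hb : 0 ≤ b) (hTb : T L δ 0 b = b) (hba : b ≤ a)
    (hTa : StrongLT (T L δ 0 a) a) :
    ∃ c, StrongLT b c ∧ c ≤ a ∧ StrongLT (L *ᵥ c + δ c) 0 := by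
  -- The strict inequality at `a` leaves room for a small shift `γ = -L⁻¹ (r, …, r) ≻ 0`. A fixed
  -- point `c` of `T_γ` then satisfies `L c + δ(c) = -(r, …, r)`.
  obtain ⟨r, hr, hTr⟩ : ∃ r : ℝ, 0 < r ∧ T L δ (-(L⁻¹ *ᵥ fun _ => r)) a ≤ a := by
    have hc : Continuous fun r : ℝ => T L δ (-(L⁻¹ *ᵥ fun _ => r)) a :=
      continuous_const.add
        (continuous_const.matrix_mulVec (continuous_pi fun _ => continuous_id)).neg
    have h0 : T L δ (-(L⁻¹ *ᵥ fun _ => (0 : ℝ))) a = T L δ 0 a := by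
      have : (fun _ : Fin n => (0 : ℝ)) = 0 := rfl
      rw [this, Matrix.mulVec_zero, neg_zero]
    have hev : ∀ᶠ r in 𝓝 (0 : ℝ), ∀ j, T L δ (-(L⁻¹ *ᵥ fun _ => r)) a j < a j := by
      refine eventually_all.2 fun j => ?_
      refine ((continuous_apply j).comp hc).tendsto 0 |>.eventually (gt_mem_nhds ?_)
      simpa only [Function.comp, h0] using hTa j
    obtain ⟨r, h1, h2⟩ :=
      ((hev.filter_mono nhdsWithin_le_nhds).and (self_mem_nhdsWithin (s := Ioi (0 : ℝ)))).exists
    exact ⟨r, h2, fun j => (h1 j).le⟩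
  set γ := -(L⁻¹ *ᵥ fun _ => r) with hγ
  have hγpos : StrongLT 0 γ := hL.strongLT_neg_inv_mulVec hM fun _ => hr
  have hTγ (x) : T L δ γ x = T L δ 0 x + γ := by simp [T]
  have hbT : b ≤ T L δ γ b := by
    rw [hTγ, hTb]
    exact le_add_of_nonneg_right hγpos.le
  obtain ⟨c, hbc, hca, hfix, -⟩ := exists_tendsto_iterate (continuousOn_T hδ γ)
    (monotoneOn_T hL hM hδ γ) hb hba hbT hTr
  refine ⟨c, fun j => ?_, hca, fun j => ?_⟩
  -- Strictness comes from `c = T_0(c) + γ ⪰ T_0(b) + γ = b + γ`.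
  · have h1 := monotoneOn_T hL hM hδ 0 hb (hb.trans hbc) hbc j
    rw [hTb] at h1
    have h2 := congrFun hfix j
    rw [hTγ, Pi.add_apply] at h2
    have h3 := hγpos j
    simp only [Pi.zero_apply] at h3
    linarith
  · have hLc : L *ᵥ c = -(δ c) - fun _ => r := by
      conv_lhs => rw [← hfix]
      simp only [T, hγ, Matrix.mulVec_add, Matrix.mulVec_neg, Matrix.mulVec_mulVec,
        Matrix.mul_nonsing_inv _ hL.isUnit_det, Matrix.one_mulVec]
      rw [sub_eq_add_neg]
    rw [hLc]
    simp only [Pi.add_apply, Pi.sub_apply, Pi.neg_apply, Pi.zero_apply]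
    linarith

end Comparison

end SwitchingSystem

/-! ### Absolutely continuous functions. -/

lemma AbsolutelyContinuousOnInterval.of_dist_le_mul {X Y : Type*} [PseudoMetricSpace X]
    [PseudoMetricSpace Y] {f : ℝ → X} {g : ℝ → Y} {a b C : ℝ}
    (hf : AbsolutelyContinuousOnInterval f a b)
    (hfg : ∀ s t, dist (g s) (g t) ≤ C * dist (f s) (f t)) :
    AbsolutelyContinuousOnInterval g a b := by
  have h := Tendsto.const_mul C hf
  rw [mul_zero] at h
  refine squeeze_zero (fun E => Finset.sum_nonneg fun i _ => dist_nonneg) (fun E => ?_) h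
  rw [Finset.mul_sum]
  exact Finset.sum_le_sum fun i _ => hfg _ _

/-- An absolutely continuous function with almost everywhere nonpositive derivative does not
increase. -/
lemma AbsolutelyContinuousOnInterval.le_of_ae_hasDerivAt_nonpos {f : ℝ → ℝ} {a b : ℝ}
    (hab : a ≤ b) (hf : AbsolutelyContinuousOnInterval f a b)
    (h : ∀ᵐ t, t ∈ Ioo a b → ∃ d, HasDerivAt f d t ∧ d ≤ 0) : f b ≤ f a := by
  have h1 := hf.integral_deriv_eq_sub
  rw [intervalIntegral.integral_of_le hab, integral_Ioc_eq_integral_Ioo] at h1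
  have h2 : ∫ t in Ioo a b, deriv f t ≤ 0 := by
    refine integral_nonpos_of_ae ?_
    rw [EventuallyLE, ae_restrict_iff' measurableSet_Ioo]
    filter_upwards [h] with t ht hmem
    obtain ⟨d, hd, hd0⟩ := ht hmem
    simpa [hd.deriv] using hd0
  linarith

namespace SwitchingSystem

/-! ### Differential inequality in the coordinates `V⁻¹ x`. -/

section Lam

variable {N n : ℕ} (A : Fin N → Matrix (Fin n) (Fin n) ℝ) (V : Matrix (Fin n) (Fin n) ℂ)

lemma metzlerPart_le_Lam (i : Fin N) (j l : Fin n) :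
    metzlerPart (V⁻¹ * (A i).map Complex.ofReal * V) j l ≤ Lam A V j l :=
  le_ciSup (f := fun i => metzlerPart (V⁻¹ * (A i).map Complex.ofReal * V) j l)
    (Set.finite_range _).bddAbove i

lemma isMetzler_Lam : IsMetzler (Lam A V) := by
  intro j l hjl
  refine Real.iSup_nonneg fun i => ?_
  simp [metzlerPart, hjl]

end Lam

lemma norm_mulVec_apply_le {m n : ℕ} (M : Matrix (Fin m) (Fin n) ℂ) (z : Fin n → ℂ) (j : Fin m) :
    ‖(M *ᵥ z) j‖ ≤ ∑ l, ‖M j l‖ * ‖z l‖ :=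
  (norm_sum_le Finset.univ fun l => M j l * z l).trans_eq (Finset.sum_congr rfl fun _ _ => norm_mul _ _)

/-- The radial derivative of a coordinate under a linear field is bounded by the Metzler part. -/
lemma inner_mulVec_apply_le {n : ℕ} (M : Matrix (Fin n) (Fin n) ℂ) (z : Fin n → ℂ) (j : Fin n) :
    inner ℝ (z j) ((M *ᵥ z) j) ≤ ‖z j‖ * ∑ l, metzlerPart M j l * ‖z l‖ := by
  rw [Matrix.mulVec, dotProduct, inner_sum, Finset.mul_sum]
  refine Finset.sum_le_sum fun l _ => ?_
  by_cases h : j = l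
  -- The diagonal term is exactly `Re (M j j) * ‖z j‖ ^ 2`, since multiplication by `i` only
  -- rotates; off the diagonal Cauchy–Schwarz is used.
  · subst h
    refine le_of_eq ?_
    have hn : ‖z j‖ * ‖z j‖ = (z j).re * (z j).re + (z j).im * (z j).im := by
      rw [← sq, Complex.sq_norm, Complex.normSq_apply]
    simp only [metzlerPart, Matrix.of_apply, if_true, Complex.inner, Complex.mul_re,
      Complex.mul_im, Complex.conj_re, Complex.conj_im]
    linear_combination -(M j j).re * hn
  · refine (real_inner_le_norm _ _).trans_eq ?_
    simp [metzlerPart, h]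

section Coordinates

variable {n : ℕ} {V : Matrix (Fin n) (Fin n) ℂ}

lemma absCoord_nonneg (x : Fin n → ℝ) : 0 ≤ absCoord V x := fun _ => norm_nonneg _

lemma abs_le_absMatrix_mulVec (hV : IsUnit V) {x c : Fin n → ℝ} (h : absCoord V x ≤ c)
    (j : Fin n) : |x j| ≤ (absMatrix V *ᵥ c) j := by
  have hx : V *ᵥ (V⁻¹ *ᵥ fun l => (x l : ℂ)) = fun l => (x l : ℂ) := by
    rw [Matrix.mulVec_mulVec, Matrix.mul_nonsing_inv _ ((Matrix.isUnit_iff_isUnit_det V).1 hV),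
      Matrix.one_mulVec]
  have h1 := norm_mulVec_apply_le V (V⁻¹ *ᵥ fun l => (x l : ℂ)) j
  rw [hx] at h1
  simp only [Complex.norm_real, Real.norm_eq_abs] at h1
  exact h1.trans (Finset.sum_le_sum fun l _ => mul_le_mul_of_nonneg_left (h l) (norm_nonneg _))

lemma absMatrix_mulVec_nonneg {c : Fin n → ℝ} (hc : 0 ≤ c) : 0 ≤ absMatrix V *ᵥ c :=
  fun j => show 0 ≤ ∑ l, ‖V j l‖ * c l from
    Finset.sum_nonneg fun l _ => mul_nonneg (norm_nonneg _) (hc l)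

lemma continuous_absCoord : Continuous (absCoord V) := by
  refine continuous_pi fun j => Continuous.norm ?_
  exact (continuous_apply j).comp (Continuous.matrix_mulVec continuous_const (by fun_prop))

lemma dist_absCoord_le (V : Matrix (Fin n) (Fin n) ℂ) (j : Fin n) (x y : Fin n → ℝ) :
    dist (absCoord V x j) (absCoord V y j) ≤ (∑ l, ‖V⁻¹ j l‖) * dist x y := by
  refine (dist_norm_norm_le _ _).trans ?_
  rw [← Pi.sub_apply, ← Matrix.mulVec_sub, Finset.sum_mul]
  refine (norm_mulVec_apply_le _ _ _).trans (Finset.sum_le_sum fun l _ => ?_)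
  refine mul_le_mul_of_nonneg_left ?_ (norm_nonneg _)
  rw [Pi.sub_apply, ← Complex.ofReal_sub, Complex.norm_real, ← dist_eq_norm]
  exact dist_le_pi_dist x y l

/-- The functions `|V⁻¹ H_i w|` with `|w| ⪯ δ_i(|V| x)` are bounded by `ψ(x)`. -/
lemma absCoord_le_psi {N : ℕ} {k : Fin N → ℕ} (H : ∀ i, Matrix (Fin n) (Fin (k i)) ℝ)
    (δw : ∀ i, (Fin n → ℝ) → (Fin (k i) → ℝ)) (V : Matrix (Fin n) (Fin n) ℂ) (x : Fin n → ℝ)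
    (i : Fin N) {w : Fin (k i) → ℝ} (hw : ∀ l, |w l| ≤ δw i (absMatrix V *ᵥ x) l) (j : Fin n) :
    absCoord V (H i *ᵥ w) j ≤ psi H δw V x j := by
  -- Compactness makes the real `sSup` in `psi` a genuine upper bound.
  have hcomp : IsCompact {w : Fin (k i) → ℝ | ∀ l, |w l| ≤ δw i (absMatrix V *ᵥ x) l} := by
    convert! isCompact_Icc (a := -δw i (absMatrix V *ᵥ x)) (b := δw i (absMatrix V *ᵥ x)) using 1
    ext w
    simp [abs_le, Pi.le_def, forall_and]
  have hcont : Continuous fun w : Fin (k i) → ℝ => absCoord V (H i *ᵥ w) j :=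
    (continuous_apply j).comp (continuous_absCoord.comp
      (Continuous.matrix_mulVec continuous_const continuous_id))
  refine (le_csSup (hcomp.image hcont).bddAbove (mem_image_of_mem _ hw)).trans ?_
  exact le_ciSup (f := fun i => sSup ((fun w : Fin (k i) → ℝ => absCoord V (H i *ᵥ w) j) ''
    {w | ∀ l, |w l| ≤ δw i (absMatrix V *ᵥ x) l})) (Set.finite_range _).bddAbove i

/-- Differential inequality for the squared coordinate magnitudes along a solution. -/
lemma exists_hasDerivAt_sq_absCoord {N : ℕ} (A : Fin N → Matrix (Fin n) (Fin n) ℝ)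
    (hV : IsUnit V) (i : Fin N) {x : ℝ → Fin n → ℝ} {u : Fin n → ℝ} {t : ℝ}
    (hx : HasDerivAt x (A i *ᵥ x t + u) t) (j : Fin n) :
    ∃ d, HasDerivAt (fun s => absCoord V (x s) j ^ 2) d t ∧
      d ≤ 2 * (absCoord V (x t) j *
        ((Lam A V *ᵥ absCoord V (x t)) j + absCoord V u j)) := by
  let cst : (Fin n → ℝ) → Fin n → ℂ := fun y l => (y l : ℂ)
  set z : Fin n → ℂ := V⁻¹ *ᵥ cst (x t) with hz
  set M := V⁻¹ * (A i).map Complex.ofReal * V with hM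
  have hVz : V *ᵥ z = cst (x t) := by
    rw [hz, Matrix.mulVec_mulVec,
      Matrix.mul_nonsing_inv _ ((Matrix.isUnit_iff_isUnit_det V).1 hV), Matrix.one_mulVec]
  have hder : HasDerivAt (fun s => (V⁻¹ *ᵥ cst (x s)) j)
      ((V⁻¹ *ᵥ cst (A i *ᵥ x t + u)) j) t := by
    simp only [Matrix.mulVec, dotProduct]
    exact HasDerivAt.fun_sum fun l _ =>
      ((hasDerivAt_pi.1 hx l).ofReal_comp).const_mul _
  have hcast : cst (A i *ᵥ x t + u) = (A i).map Complex.ofReal *ᵥ cst (x t) + cst u := by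
    ext l
    simp [cst, Matrix.mulVec, dotProduct]
  have hval : V⁻¹ *ᵥ cst (A i *ᵥ x t + u) = M *ᵥ z + V⁻¹ *ᵥ cst u := by
    rw [hcast, Matrix.mulVec_add, ← hVz, Matrix.mulVec_mulVec, Matrix.mulVec_mulVec, hM,
      Matrix.mul_assoc]
  -- The square is differentiable even where the coordinate vanishes, unlike the magnitude itself.
  refine ⟨_, hder.norm_sq, ?_⟩
  rw [hval, Pi.add_apply, inner_add_right, mul_add (absCoord V (x t) j)]
  have h1 : inner ℝ (z j) ((M *ᵥ z) j) ≤ ‖z j‖ * (Lam A V *ᵥ absCoord V (x t)) j := by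
    refine (inner_mulVec_apply_le M z j).trans (mul_le_mul_of_nonneg_left ?_ (norm_nonneg _))
    exact Finset.sum_le_sum fun l _ =>
      mul_le_mul_of_nonneg_right (metzlerPart_le_Lam A V i j l) (norm_nonneg _)
  have h2 : inner ℝ (z j) ((V⁻¹ *ᵥ cst u) j) ≤ ‖z j‖ * absCoord V u j := real_inner_le_norm _ _
  have h3 : absCoord V (x t) j = ‖z j‖ := rfl
  rw [h3]
  linarith

end Coordinates

/-! ### Invariance of strict boxes along trajectories. -/

section Trajectory

variable {N n : ℕ} {k : Fin N → ℕ} {A : Fin N → Matrix (Fin n) (Fin n) ℝ}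
  {H : ∀ i, Matrix (Fin n) (Fin (k i)) ℝ} {δw : ∀ i, (Fin n → ℝ) → (Fin (k i) → ℝ)} {τ : ℝ}
  {V : Matrix (Fin n) (Fin n) ℂ} {δ : (Fin n → ℝ) → (Fin n → ℝ)} {σ : ℝ → Fin N}
  {w : ∀ i, ℝ → Fin (k i) → ℝ} {x : ℝ → Fin n → ℝ} {c : Fin n → ℝ}

lemma theta_nonneg (t : ℝ) : 0 ≤ theta τ x t := fun j =>
  Real.sSup_nonneg (by rintro _ ⟨s, -, rfl⟩; exact abs_nonneg _)

lemma theta_le_absMatrix_mulVec (hV : IsUnit V) (hc : 0 ≤ c) {t : ℝ}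
    (h : ∀ s ∈ Icc (t - τ) t, absCoord V (x s) ≤ c) : theta τ x t ≤ absMatrix V *ᵥ c := by
  intro j
  refine Real.sSup_le ?_ (absMatrix_mulVec_nonneg hc j)
  rintro _ ⟨s, hs, rfl⟩
  exact abs_le_absMatrix_mulVec hV (h s hs) j

/-- As long as the past stays in the box `{|V⁻¹ x| ⪯ c}`, the perturbation is bounded by `δ(c)`. -/
lemma IsTrajectory.absCoord_perturbation_le (hx : IsTrajectory A H δw τ σ w x)
    (hδw : ∀ i, IsContCNI (δw i)) (hV : IsUnit V) (hδψ : ∀ x, 0 ≤ x → psi H δw V x ≤ δ x)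
    (hc : 0 ≤ c) {t : ℝ} (ht : 0 ≤ t) (h : ∀ s ∈ Icc (t - τ) t, absCoord V (x s) ≤ c) :
    absCoord V (H (σ t) *ᵥ w (σ t) t) ≤ δ c := by
  intro j
  refine (absCoord_le_psi H δw V c (σ t) (fun l => ?_) j).trans (hδψ c hc j)
  exact (hx.bound t ht _ l).trans ((hδw _).monotoneOn (theta_nonneg t)
    (absMatrix_mulVec_nonneg hc) (theta_le_absMatrix_mulVec hV hc h) l)

/-- A trajectory cannot leave the box `{|V⁻¹ x| ≺ c}` if `Λ c + δ(c) ≺ 0`. -/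
lemma IsTrajectory.absCoord_strongLT (hx : IsTrajectory A H δw τ σ w x)
    (hδw : ∀ i, IsContCNI (δw i)) (hτ : 0 ≤ τ) (hV : IsUnit V)
    (hδψ : ∀ x, 0 ≤ x → psi H δw V x ≤ δ x) (hc : 0 ≤ c)
    (hneg : StrongLT (Lam A V *ᵥ c + δ c) 0)
    (hinit : ∀ t ∈ Icc (-τ) 0, StrongLT (absCoord V (x t)) c) {t : ℝ} (ht : -τ ≤ t) :
    StrongLT (absCoord V (x t)) c := by
  rcases le_total t 0 with ht0 | ht0
  · exact hinit t ⟨ht, ht0⟩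
  set r : ℝ → Fin n → ℝ := fun s => absCoord V (x s) with hr
  have hrc (j : Fin n) : ContinuousOn (fun s => r s j) (Ici 0) :=
    ((continuous_apply j).comp continuous_absCoord).comp_continuousOn
      (hx.continuousOn.mono (Ici_subset_Ici.2 (by linarith)))
  by_contra hcon
  -- Times at which some coordinate has reached its bound; `t₀ = sInf S` is the first exit time.
  set S : Set ℝ := ⋃ j, {s ∈ Ici (0 : ℝ) | c j ≤ r s j} with hS
  have hSmem (s : ℝ) (hs : 0 ≤ s) (hsS : s ∉ S) : StrongLT (r s) c := by
    intro j
    by_contra hj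
    exact hsS (mem_iUnion.2 ⟨j, hs, not_lt.1 hj⟩)
  have hSclosed : IsClosed S := isClosed_iUnion_of_finite fun j =>
    isClosed_Ici.isClosed_le continuousOn_const (hrc j)
  have hSbdd : BddBelow S := ⟨0, fun s hs => (mem_iUnion.1 hs).choose_spec.1⟩
  have hSne : S.Nonempty := ⟨t, by_contra fun h => hcon (hSmem t ht0 h)⟩
  set t₀ := sInf S
  obtain ⟨j, ht₀, hj⟩ := mem_iUnion.1 (hSclosed.csInf_mem hSne hSbdd)
  change 0 ≤ t₀ at ht₀
  change c j ≤ r t₀ j at hj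
  have hbefore (s : ℝ) (hs : -τ ≤ s) (hst : s < t₀) : StrongLT (r s) c := by
    rcases le_total s 0 with hs0 | hs0
    · exact hinit s ⟨hs, hs0⟩
    · exact hSmem s hs0 fun h => absurd (csInf_le hSbdd h) (not_le.2 hst)
  have hpos : 0 < t₀ := by
    refine lt_of_le_of_ne ht₀ fun h => ?_
    rw [← h] at hj
    exact absurd (hinit 0 ⟨by linarith, le_rfl⟩ j) (not_lt.2 hj)
  have hleft : Tendsto (fun s => r s j) (𝓝[<] t₀) (𝓝 (r t₀ j)) :=
    ((hrc j).continuousAt (Ici_mem_nhds hpos)).tendsto.mono_left nhdsWithin_le_nhds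
  have hIoo : Ioo 0 t₀ ∈ 𝓝[<] t₀ := Ioo_mem_nhdsLT hpos
  have hjeq : r t₀ j = c j := le_antisymm
    (le_of_tendsto hleft (by
      filter_upwards [hIoo] with s hs
      exact (hbefore s (by linarith [hs.1]) hs.2 j).le)) hj
  have hsplit (v : Fin n → ℝ) : (Lam A V *ᵥ v) j
      = Lam A V j j * v j + ∑ l ∈ Finset.univ.erase j, Lam A V j l * v l :=
    (Finset.add_sum_erase _ _ (Finset.mem_univ j)).symm
  -- Only the off-diagonal terms may be majorized through `r s l ≤ c l`, since `Λ j j` can be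
  -- negative. The diagonal term is handled by continuity, as `r s j → c j`.
  have hev : ∀ᶠ s in 𝓝[<] t₀, Lam A V j j * r s j
      + ∑ l ∈ Finset.univ.erase j, Lam A V j l * c l + δ c j < 0 := by
    refine (((hleft.const_mul _).add_const _).add_const _).eventually (gt_mem_nhds ?_)
    rw [hjeq, ← hsplit]
    exact hneg j
  obtain ⟨a, ha, hIa⟩ := (mem_nhdsLT_iff_exists_mem_Ico_Ioo_subset hpos).1 (hev)
  obtain ⟨t₁, h1a, h1t⟩ := exists_between ha.2
  have h10 : 0 ≤ t₁ := ha.1.trans h1a.le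
  have hAC : AbsolutelyContinuousOnInterval (fun s => r s j ^ 2) t₁ t₀ := by
    have hr1 : AbsolutelyContinuousOnInterval (fun s => r s j) t₁ t₀ :=
      ((hx.absolutelyContinuous t₀ ht₀).of_dist_le_mul
        fun s s' => dist_absCoord_le V j (x s) (x s')).mono (by
          rw [uIcc_of_le h1t.le, uIcc_of_le ht₀]
          exact Icc_subset_Icc_left h10)
    simpa only [sq, smul_eq_mul] using hr1.fun_smul hr1
  have hmono := hAC.le_of_ae_hasDerivAt_nonpos h1t.le (by
    filter_upwards [(ae_restrict_iff' measurableSet_Ici).1 hx.hasDerivAt] with s hs hmem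
    have hs0 : 0 ≤ s := h10.trans hmem.1.le
    obtain ⟨d, hd, hdle⟩ := exists_hasDerivAt_sq_absCoord A hV (σ s) (hs hs0) j
    refine ⟨d, hd, hdle.trans ?_⟩
    have hu := hx.absCoord_perturbation_le hδw hV hδψ hc hs0 (fun s' hs' =>
      (hbefore s' (by linarith [hs'.1]) (hs'.2.trans_lt hmem.2)).le) j
    have hsum : ∑ l ∈ Finset.univ.erase j, Lam A V j l * r s l
        ≤ ∑ l ∈ Finset.univ.erase j, Lam A V j l * c l :=
      Finset.sum_le_sum fun l hl => mul_le_mul_of_nonneg_left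
        (hbefore s (by linarith) hmem.2 l).le
        (isMetzler_Lam A V _ _ (Finset.ne_of_mem_erase hl).symm)
    have hlt := hIa ⟨h1a.trans hmem.1, hmem.2⟩
    rw [mem_ofPred_eq] at hlt
    rw [hsplit]
    have : 0 ≤ absCoord V (x s) j := absCoord_nonneg _ j
    refine mul_nonpos_of_nonneg_of_nonpos zero_le_two
      (mul_nonpos_of_nonneg_of_nonpos this ?_)
    simp only [hr] at hlt hsum
    linarith)
  -- Now `c j ^ 2 ≤ r t₁ j ^ 2`, although `0 ≤ r t₁ j < c j`.
  have h1 := hbefore t₁ (by linarith) h1t j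
  have h2 : 0 ≤ r t₁ j := absCoord_nonneg _ j
  simp only [hjeq] at hmono
  nlinarith

end Trajectory

end SwitchingSystem

theorem mainTheorem6 {N n : ℕ} [NeZero N] {k : Fin N → ℕ}
    (A : Fin N → Matrix (Fin n) (Fin n) ℝ)
    (H : ∀ i, Matrix (Fin n) (Fin (k i)) ℝ)
    (δw : ∀ i, (Fin n → ℝ) → (Fin (k i) → ℝ))
    (hδw : ∀ i, SwitchingSystem.IsContCNI (δw i))
    (τ : ℝ) (hτ : 0 ≤ τ)
    (V : Matrix (Fin n) (Fin n) ℂ) (hV : IsUnit V)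
    (hΛ : SwitchingSystem.IsHurwitz (SwitchingSystem.Lam A V))
    (δ : (Fin n → ℝ) → (Fin n → ℝ)) (hδ : SwitchingSystem.IsContCNI δ)
    (hδψ : ∀ x, 0 ≤ x → SwitchingSystem.psi H δw V x ≤ δ x)
    (β : Fin n → ℝ) (hβ : 0 ≤ β)
    (hTβ : StrongLT (SwitchingSystem.T (SwitchingSystem.Lam A V) δ 0 β) β) :
    ∃ b : Fin n → ℝ, 0 ≤ b ∧
      Tendsto (fun m : ℕ => (SwitchingSystem.T (SwitchingSystem.Lam A V) δ 0)^[m] β)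
        atTop (𝓝 b) ∧
      ((∀ ε : Fin n → ℝ, StrongLT 0 ε → ∃ βε : Fin n → ℝ, b ≤ βε ∧ βε ≤ b + ε ∧
          StrongLT (SwitchingSystem.T (SwitchingSystem.Lam A V) δ 0 βε) βε) →
        ∀ (σ : ℝ → Fin N) (w : ∀ i, ℝ → Fin (k i) → ℝ) (x : ℝ → Fin n → ℝ),
          SwitchingSystem.IsTrajectory A H δw τ σ w x →
          (∀ t ∈ Icc (-τ) 0, SwitchingSystem.absCoord V (x t) ≤ b) →
          ∀ t, -τ ≤ t → SwitchingSystem.absCoord V (x t) ≤ b) := by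

  have hM := SwitchingSystem.isMetzler_Lam A V
  -- The origin serves as the lower barrier, because `T_0(0) = -Λ⁻¹ δ(0) ⪰ 0`.
  obtain ⟨b, hb, -, hTb, hlim⟩ := SwitchingSystem.exists_tendsto_iterate
    (SwitchingSystem.continuousOn_T hδ 0) (SwitchingSystem.monotoneOn_T hΛ hM hδ 0) le_rfl hβ
    (by
      have h := hΛ.neg_inv_mulVec_nonneg hM (hδ.mapsTo (self_mem_Ici (a := 0)))
      simpa [SwitchingSystem.T] using h) hTβ.le
  refine ⟨b, hb, hlim, fun happ σ w x hx hinit t ht j => le_of_forall_pos_le_add fun ε hε => ?_⟩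
  obtain ⟨a, hba, hab, hTa⟩ := happ (fun _ => ε) fun _ => hε
  obtain ⟨c, hbc, hca, hneg⟩ :=
    SwitchingSystem.exists_strict_supersolution hΛ hM hδ hb hTb hba hTa
  -- The initial bound `⪯ b` is strict with respect to `c ≻ b`.
  have h := hx.absCoord_strongLT hδw hτ hV hδψ (hb.trans hbc.le) hneg
    (fun s hs l => (hinit s hs l).trans_lt (hbc l)) ht j
  exact h.le.trans ((hca j).trans (hab j))
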